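/- Let $\mathcal X$ be a measurable space, $a\le 0<b$ real numbers, $z=\max\{|a|,|b|\}$, and let $\mathcal F$ be a nonempty class of measurable functions $f:\mathcal X\to[a,b]$. Let $m\ge 1$ and let $\mathcal S=(s_1,\dots,s_m)$ be i.i.d. random elements of $\mathcal X$ with law $\mu$. Define the wimpy variance and the empirical wimpy variance by $$\sigma^2_{\mathcal F}=\sup_{f\in\mathcal F}\mathbb E_{\mu}[f^2],\qquad \hat\sigma^2_{\mathcal F}(\mathcal S)=\frac1m\sup_{f\in\mathcal F}\sum_{i=1}^m f(s_i)^2,$$ and assume that $\hat\sigma^2_{\mathcal F}(\mathcal S)$ is a random variable (measurable up to null sets). Let $h(x)=(1+x)\ln(1+x)-x$ for $x\ge-1$ (with $0\ln 0=0$). A function $g:\mathcal X^m\to[0,\infty)$ is called $(\alpha,\beta)$-self-bounding if there are functions $g_i:\mathcal X^{m-1}\to\mathbb R$, $1\le i\le m$, such that for every $x\in\mathcal X^m$, writing $x^{(i)}$ for $x$ with its $i$-th component dropped, $0\le g(x)-g_i(x^{(i)})\le 1$ for all $i$ and $\sum_{i=1}^m\bigl(g(x)-g_i(x^{(i)})\bigr)\le\alpha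 g(x)+\beta$. Then: 1. the function $\mathcal S\mapsto m\,\hat\sigma^2_{\mathcal F}(\mathcal S)/z^2$ on $\mathcal X^m$ is $(1,0)$-self-bounding; 2. $\hat\sigma^2_{\mathcal F}(\mathcal S)$ is integrable and $\sigma^2_{\mathcal F}\le\mathbb E_{\mathcal S}[\hat\sigma^2_{\mathcal F}(\mathcal S)]$; 3. if $\sigma^2_{\mathcal F}>0$, then for every $0\le\varepsilon\le\sigma^2_{\mathcal F}$, $$\Pr\left(\sigma^2_{\mathcal F}\ge\hat\sigma^2_{\mathcal F}(\mathcal S)+\varepsilon\right)\le\exp\left(-\frac{m\sigma^2_{\mathcal F}}{z^2}\,h\left(-\frac{\varepsilon}{\sigma^2_{\mathcal F}}\right)\right)\le\exp\left(-\frac{m\varepsilon^2}{2z^2\sigma^2_{\mathcal F}}\right);$$ 4. for every $\delta\in(0,1]$, with probability at least $1-\delta$, $$\sigma^2_{\mathcal F}\le\hat\sigma^2_{\mathcal F}(\mathcal S)+\frac{z^2\ln(1/\delta)}{m}+\sqrt{\left(\frac{z^2\ln(1/\delta)}{m}\right)^2+\frac{2z^2\,\hat\sigma^2_{\mathcal F}(\mathcal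 S)\ln(1/\delta)}{m}}.$$ -/

import Mathlib

open MeasureTheory ProbabilityTheory

noncomputable section

/-- The wimpy variance `sup_{f ∈ F} E[f(X)^2]`, where `X` has law `μ`. -/
def wimpyVariance {𝓧 : Type*} [MeasurableSpace 𝓧] (F : Set (𝓧 → ℝ)) (μ : Measure 𝓧) : ℝ :=
  ⨆ f : F, ∫ x, (f : 𝓧 → ℝ) x ^ 2 ∂μ

/-- The empirical wimpy variance `(1/m) sup_{f ∈ F} ∑_i f(s_i)^2` of a sample `s` of size `m`. -/
def empWimpyVariance {𝓧 : Type*} (F : Set (𝓧 → ℝ)) {m : ℕ} (s : Fin m → 𝓧) : ℝ :=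
  (1 / (m : ℝ)) * ⨆ f : F, ∑ i, (f : 𝓧 → ℝ) (s i) ^ 2

/-- `g : 𝓧ⁿ → ℝ` is a non-negative (strongly) `(α, β)`-self-bounding function: there are functions
`gᵢ` of the remaining `n - 1` coordinates (those with an index different from `i`) such that
`0 ≤ g(x) - gᵢ(x⁽ⁱ⁾) ≤ 1` and `∑ᵢ (g(x) - gᵢ(x⁽ⁱ⁾)) ≤ α g(x) + β` for every `x`. -/
def IsSelfBounding {𝓧 : Type*} {n : ℕ} (α β : ℝ) (g : (Fin n → 𝓧) → ℝ) : Prop :=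
  (∀ x, 0 ≤ g x) ∧
  ∃ g' : (i : Fin n) → ({j : Fin n // j ≠ i} → 𝓧) → ℝ,
    ∀ x : Fin n → 𝓧,
      (∀ i, 0 ≤ g x - g' i (fun j => x j) ∧ g x - g' i (fun j => x j) ≤ 1) ∧
      ∑ i, (g x - g' i (fun j => x j)) ≤ α * g x + β

/-- The function `h(x) = (1 + x) log (1 + x) - x`, used for `x ≥ -1`, with `0 log 0 = 0`. -/
def bennettH (x : ℝ) : ℝ := (1 + x) * Real.log (1 + x) - x

end

/-! The lower tail of the supremum needs no concentration inequality for suprema. For each fixed `f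
∈ F`, the empirical wimpy variance dominates the empirical mean of `f²`, so it can be small only if
that mean is. The variables `f(sᵢ)²/z²` are i.i.d. in `[0, 1]`, and comparing them with Poisson
variables gives a Chernoff bound (`measureReal_sum_le_le_exp`) depending on `f` only through `E f²`.
This bound is continuous in `E f²`, so it passes to the supremum `σ²`; optimizing the parameter
yields `h`. Self-boundedness is a separate counting argument, not used for the tail. For the
empirical bound, choose `ε` so that the Gaussian-type tail equals `δ`, then solve the resulting
quadratic inequality for `σ²`. -/

/-- The exponential lies below its chord on `[0, 1]`. -/
lemma exp_mul_le_chord {t x : ℝ} (h0 : 0 ≤ x) (h1 : x ≤ 1) :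
    Real.exp (t * x) ≤ 1 + x * (Real.exp t - 1) := by
  have h := convexOn_exp.2 (Set.mem_univ (0 : ℝ)) (Set.mem_univ t)
    (sub_nonneg.2 h1) h0 (by ring)
  simp only [smul_eq_mul, mul_zero, zero_add, Real.exp_zero] at h
  rw [mul_comm x t] at h
  linarith

/-- The moment generating function of a `[0, 1]`-valued variable is at most that of a Poisson
variable with the same mean. -/
lemma mgf_le_exp_of_mem_unitInterval {Ω : Type*} [MeasurableSpace Ω] {P : Measure Ω}
    [IsProbabilityMeasure P] {X : Ω → ℝ} (hX : Measurable X)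
    (h01 : ∀ ω, X ω ∈ Set.Icc (0 : ℝ) 1) (t : ℝ) :
    mgf X P t ≤ Real.exp ((∫ ω, X ω ∂P) * (Real.exp t - 1)) := by
  have hint : Integrable X P :=
    Integrable.of_mem_Icc 0 1 hX.aemeasurable (Filter.Eventually.of_forall h01)
  have hint2 : Integrable (fun ω => 1 + X ω * (Real.exp t - 1)) P :=
    (integrable_const 1).add (hint.mul_const _)
  have h1 : mgf X P t ≤ ∫ ω, (1 + X ω * (Real.exp t - 1)) ∂P :=
    integral_mono_of_nonneg (Filter.Eventually.of_forall fun ω => (Real.exp_pos _).le) hint2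
      (Filter.Eventually.of_forall fun ω => exp_mul_le_chord (h01 ω).1 (h01 ω).2)
  rw [integral_add (integrable_const 1) (hint.mul_const _), integral_mul_const] at h1
  simp only [integral_const, probReal_univ, smul_eq_mul, mul_one] at h1
  refine h1.trans ?_
  rw [add_comm]
  exact Real.add_one_le_exp _

/-- Multiplicative Chernoff bound for the lower tail of a sum of independent `[0, 1]`-valued
variables with a common mean, before optimization of the parameter. -/
lemma measureReal_sum_le_le_exp {Ω : Type*} [MeasurableSpace Ω] {P : Measure Ω}
    [IsProbabilityMeasure P] {m : ℕ} {X : Fin m → Ω → ℝ} (hX : ∀ i, Measurable (X i))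
    (h01 : ∀ i ω, X i ω ∈ Set.Icc (0 : ℝ) 1) (hind : iIndepFun X P) {p : ℝ}
    (hp : ∀ i, ∫ ω, X i ω ∂P = p) {l : ℝ} (hl : 0 ≤ l) (c : ℝ) :
    P.real {ω | ∑ i, X i ω ≤ c} ≤ Real.exp (l * c + m * p * (Real.exp (-l) - 1)) := by
  have hint : Integrable (fun ω => Real.exp (-l * (∑ i, X i) ω)) P := by
    refine Integrable.of_mem_Icc 0 1 ?_ (Filter.Eventually.of_forall fun ω => ⟨(Real.exp_pos _).le, ?_⟩)
    · have : Measurable (∑ i, X i) := by fun_prop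
      fun_prop
    · rw [Real.exp_le_one_iff, Finset.sum_apply]
      have : 0 ≤ ∑ i, X i ω := Finset.sum_nonneg fun i _ => (h01 i ω).1
      nlinarith
  have h := measure_le_le_exp_mul_mgf c (neg_nonpos.2 hl) hint
  simp only [Finset.sum_apply] at h
  refine h.trans ?_
  rw [hind.mgf_sum hX, neg_neg, Real.exp_add]
  gcongr
  calc ∏ i, mgf (X i) P (-l) ≤ ∏ _i : Fin m, Real.exp (p * (Real.exp (-l) - 1)) :=
        Finset.prod_le_prod (fun i _ => mgf_nonneg) fun i _ => by
          rw [← hp i]; exact mgf_le_exp_of_mem_unitInterval (hX i) (h01 i) _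
    _ = Real.exp (m * p * (Real.exp (-l) - 1)) := by
        rw [Finset.prod_const, Finset.card_univ, Fintype.card_fin, ← Real.exp_nat_mul, mul_assoc]

/-- `t² / 2 ≤ h(-t)` on `[0, 1]`. -/
lemma sq_div_two_le_bennettH_neg {t : ℝ} (h0 : 0 ≤ t) (h1 : t ≤ 1) :
    t ^ 2 / 2 ≤ bennettH (-t) := by
  unfold bennettH
  rcases h1.eq_or_lt with rfl | h1
  · norm_num
  have hu : 0 < 1 + -t := by linarith
  have hlog : Real.log (1 + -t) ≤ 0 := Real.log_nonpos hu.le (by linarith)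
  -- With `u = 1 - t`, applying `x ≤ sinh x` at `x = -log u` gives `log u ≥ (u - 1/u)/2`;
  -- multiplying by `u` makes this polynomial.
  have h := Real.self_le_sinh_iff.2 (neg_nonneg.2 hlog)
  rw [Real.sinh_neg, Real.sinh_log hu] at h
  have h2 : (1 + -t) * (((1 + -t) - (1 + -t)⁻¹) / 2) ≤ (1 + -t) * Real.log (1 + -t) :=
    mul_le_mul_of_nonneg_left (by linarith) hu.le
  have h3 : (1 + -t) * (((1 + -t) - (1 + -t)⁻¹) / 2) = ((1 + -t) ^ 2 - 1) / 2 := by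
    field_simp
  nlinarith

/-- The quadratic inequality behind the empirical bound. -/
lemma le_add_sqrt_of_lt_add_sqrt {v u A : ℝ} (hA : 0 ≤ A)
    (h : v < u + Real.sqrt (2 * A * v)) : v ≤ u + A + Real.sqrt (A ^ 2 + 2 * A * u) := by
  by_contra! hcon
  have hR : 0 ≤ Real.sqrt (A ^ 2 + 2 * A * u) := Real.sqrt_nonneg _
  have h1 : Real.sqrt (A ^ 2 + 2 * A * u) < v - u - A := by linarith
  rw [Real.sqrt_lt' (by linarith)] at h1
  have h2 : v - u < Real.sqrt (2 * A * v) := by linarith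
  rw [Real.lt_sqrt (by linarith)] at h2
  nlinarith

/-! ### Deterministic properties of the empirical wimpy variance -/

section Class

variable {𝓧 : Type*} {F : Set (𝓧 → ℝ)} {z : ℝ}

lemma bddAbove_sum_sq {ι : Type*} [Fintype ι] (hF : ∀ f ∈ F, ∀ x, |f x| ≤ z) (s : ι → 𝓧) :
    BddAbove (Set.range fun f : F => ∑ i, (f : 𝓧 → ℝ) (s i) ^ 2) := by
  refine ⟨∑ _i : ι, z ^ 2, ?_⟩
  rintro _ ⟨f, rfl⟩
  exact Finset.sum_le_sum fun i _ => sq_le_sq.2 ((hF f f.2 _).trans (le_abs_self z))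

lemma sum_sq_le_mul_empWimpyVariance {m : ℕ} (hm : 0 < m) (hF : ∀ f ∈ F, ∀ x, |f x| ≤ z)
    {f : 𝓧 → ℝ} (hf : f ∈ F) (s : Fin m → 𝓧) :
    ∑ i, f (s i) ^ 2 ≤ m * empWimpyVariance F s := by
  have hm' : (m : ℝ) ≠ 0 := by positivity
  unfold empWimpyVariance
  rw [← mul_assoc, mul_one_div_cancel hm', one_mul]
  exact le_ciSup (bddAbove_sum_sq hF s) ⟨f, hf⟩

lemma empWimpyVariance_nonneg {m : ℕ} (s : Fin m → 𝓧) : 0 ≤ empWimpyVariance F s :=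
  mul_nonneg (by positivity)
    (Real.iSup_nonneg fun _ => Finset.sum_nonneg fun _ _ => sq_nonneg _)

lemma empWimpyVariance_le {m : ℕ} (hm : 0 < m) (hF : ∀ f ∈ F, ∀ x, |f x| ≤ z) (s : Fin m → 𝓧) :
    empWimpyVariance F s ≤ z ^ 2 := by
  have hm' : (0 : ℝ) < m := by positivity
  unfold empWimpyVariance
  rw [one_div, inv_mul_le_iff₀ hm']
  refine Real.iSup_le (fun f => ?_) (by positivity)
  calc ∑ i, (f : 𝓧 → ℝ) (s i) ^ 2 ≤ ∑ _i : Fin m, z ^ 2 :=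
        Finset.sum_le_sum fun i _ => sq_le_sq.2 ((hF f f.2 _).trans (le_abs_self z))
    _ = m * z ^ 2 := by simp

/-- Take for `gᵢ` the same supremum over the remaining coordinates: dropping one coordinate lowers
each sum by at most `z²`. -/
lemma isSelfBounding_empWimpyVariance {m : ℕ} (hm : 0 < m) (hne : F.Nonempty) (hz : 0 < z)
    (hF : ∀ f ∈ F, ∀ x, |f x| ≤ z) :
    IsSelfBounding 1 0 (fun s : Fin m → 𝓧 => (m : ℝ) * empWimpyVariance F s / z ^ 2) := by
  have : Nonempty F := hne.to_subtype
  have hm' : (m : ℝ) ≠ 0 := by positivity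
  refine ⟨fun s => by have := empWimpyVariance_nonneg (F := F) s; positivity,
    fun i y => (⨆ f : F, ∑ j, (f : 𝓧 → ℝ) (y j) ^ 2) / z ^ 2, fun s => ?_⟩
  have hG : (m : ℝ) * empWimpyVariance F s = ⨆ f : F, ∑ i, (f : 𝓧 → ℝ) (s i) ^ 2 := by
    unfold empWimpyVariance
    rw [← mul_assoc, mul_one_div_cancel hm', one_mul]
  have hsplit (i : Fin m) (f : 𝓧 → ℝ) :
      ∑ j, f (s j) ^ 2 = f (s i) ^ 2 + ∑ j : {j : Fin m // j ≠ i}, f (s j) ^ 2 :=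
    Fintype.sum_eq_add_sum_subtype_ne (fun j => f (s j) ^ 2) i
  have hdrop (i : Fin m) := bddAbove_sum_sq hF (fun j : {j : Fin m // j ≠ i} => s j)
  have hfull := bddAbove_sum_sq hF s
  simp only [hG, one_mul, add_zero, ← sub_div]
  refine ⟨fun i => ⟨div_nonneg (sub_nonneg.2 ?_) (by positivity), ?_⟩, ?_⟩
  · refine ciSup_mono hfull fun f => ?_
    rw [hsplit i]
    exact le_add_of_nonneg_left (sq_nonneg _)
  · rw [div_le_one (by positivity), sub_le_iff_le_add]
    refine ciSup_le fun f => ?_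
    rw [hsplit i]
    exact add_le_add (sq_le_sq.2 ((hF f f.2 _).trans (le_abs_self z))) (le_ciSup (hdrop i) f)
  · rw [← Finset.sum_div]
    gcongr
    rw [Finset.sum_sub_distrib, Finset.sum_const, Finset.card_univ, Fintype.card_fin, nsmul_eq_mul]
    have hm1 : (0 : ℝ) ≤ m - 1 := sub_nonneg.2 (by exact_mod_cast hm)
    -- Each index survives in exactly `m - 1` of the `m` leave-one-out sums, so for fixed `f` these
    -- add up to `m - 1` times the full sum.
    suffices h : ((m : ℝ) - 1) * (⨆ f : F, ∑ i, (f : 𝓧 → ℝ) (s i) ^ 2) ≤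
        ∑ i, ⨆ f : F, ∑ j : {j : Fin m // j ≠ i}, (f : 𝓧 → ℝ) (s j) ^ 2 by linarith
    rw [Real.mul_iSup_of_nonneg hm1]
    refine ciSup_le fun f => ?_
    calc ((m : ℝ) - 1) * ∑ i, (f : 𝓧 → ℝ) (s i) ^ 2
        = ∑ i, ∑ j : {j : Fin m // j ≠ i}, (f : 𝓧 → ℝ) (s j) ^ 2 := by
          have h (i : Fin m) : ∑ j : {j : Fin m // j ≠ i}, (f : 𝓧 → ℝ) (s j) ^ 2 =
              ∑ j, (f : 𝓧 → ℝ) (s j) ^ 2 - (f : 𝓧 → ℝ) (s i) ^ 2 := by rw [hsplit i]; ring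
          simp only [h, Finset.sum_sub_distrib, Finset.sum_const, Finset.card_univ,
            Fintype.card_fin, nsmul_eq_mul]
          ring
      _ ≤ _ := Finset.sum_le_sum fun i _ => le_ciSup (hdrop i) f

end Class

/-! ### Expectation and lower tail for an i.i.d. sample -/

section Sample

variable {𝓧 Ω : Type*} [MeasurableSpace Ω] {P : Measure Ω} [IsProbabilityMeasure P]
  {F : Set (𝓧 → ℝ)} {z : ℝ} {m : ℕ} {S : Fin m → Ω → 𝓧}

lemma integrable_empWimpyVariance (hm : 0 < m) (hF : ∀ f ∈ F, ∀ x, |f x| ≤ z)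
    (hmeas : AEMeasurable (fun ω => empWimpyVariance F (fun i => S i ω)) P) :
    Integrable (fun ω => empWimpyVariance F (fun i => S i ω)) P :=
  Integrable.of_mem_Icc 0 (z ^ 2) hmeas (Filter.Eventually.of_forall fun _ =>
    ⟨empWimpyVariance_nonneg _, empWimpyVariance_le hm hF _⟩)

variable [MeasurableSpace 𝓧] {μ : Measure 𝓧}

/-- The expectation of a supremum dominates each expectation, hence their supremum. -/
lemma wimpyVariance_le_integral (hm : 0 < m) (hne : F.Nonempty)
    (hFm : ∀ f ∈ F, Measurable f) (hF : ∀ f ∈ F, ∀ x, |f x| ≤ z)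
    (hS : ∀ i, Measurable (S i)) (hlaw : ∀ i, P.map (S i) = μ)
    (hmeas : AEMeasurable (fun ω => empWimpyVariance F (fun i => S i ω)) P) :
    wimpyVariance F μ ≤ ∫ ω, empWimpyVariance F (fun i => S i ω) ∂P := by
  have : Nonempty F := hne.to_subtype
  have hm' : (0 : ℝ) < m := by positivity
  refine ciSup_le fun ⟨f, hf⟩ => ?_
  have hfm := hFm f hf
  have hi (i : Fin m) : Integrable (fun ω => f (S i ω) ^ 2) P :=
    Integrable.of_mem_Icc 0 (z ^ 2) ((hfm.comp (hS i)).pow_const 2).aemeasurable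
      (Filter.Eventually.of_forall fun ω =>
        ⟨sq_nonneg _, sq_le_sq.2 ((hF f hf _).trans (le_abs_self z))⟩)
  have hmean (i : Fin m) : ∫ ω, f (S i ω) ^ 2 ∂P = ∫ x, f x ^ 2 ∂μ := by
    rw [← hlaw i, integral_map (hS i).aemeasurable (hfm.pow_const 2).aestronglyMeasurable]
  have h := integral_mono (integrable_finsetSum _ fun i _ => hi i)
    ((integrable_empWimpyVariance hm hF hmeas).const_mul (m : ℝ))
    (fun ω => sum_sq_le_mul_empWimpyVariance hm hF hf fun i => S i ω)
  rw [integral_finsetSum _ fun i _ => hi i, integral_const_mul] at h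
  simp only [hmean, Finset.sum_const, Finset.card_univ, Fintype.card_fin, nsmul_eq_mul] at h
  exact le_of_mul_le_mul_left h hm'

/-- Exponential-moment form of the lower tail bound for the empirical wimpy variance. -/
lemma measureReal_empWimpyVariance_add_le (hm : 0 < m) (hne : F.Nonempty) (hz : 0 < z)
    (hFm : ∀ f ∈ F, Measurable f) (hF : ∀ f ∈ F, ∀ x, |f x| ≤ z)
    (hS : ∀ i, Measurable (S i)) (hind : iIndepFun S P) (hlaw : ∀ i, P.map (S i) = μ)
    (c : ℝ) {l : ℝ} (hl : 0 ≤ l) :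
    P.real {ω | empWimpyVariance F (fun i => S i ω) ≤ c} ≤
      Real.exp (m / z ^ 2 * (l * c + wimpyVariance F μ * (Real.exp (-l) - 1))) := by
  have : Nonempty F := hne.to_subtype
  have hm' : (0 : ℝ) < m := by positivity
  have key (f : F) : P.real {ω | empWimpyVariance F (fun i => S i ω) ≤ c} ≤
      Real.exp (m / z ^ 2 * (l * c + (∫ x, (f : 𝓧 → ℝ) x ^ 2 ∂μ) * (Real.exp (-l) - 1))) := by
    obtain ⟨f, hf⟩ := f
    have hfm := hFm f hf
    have hgm : Measurable (fun x => f x ^ 2 / z ^ 2) := (hfm.pow_const 2).div_const _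
    have hchern := measureReal_sum_le_le_exp (P := P) (X := fun i ω => f (S i ω) ^ 2 / z ^ 2)
      (p := (∫ x, f x ^ 2 ∂μ) / z ^ 2) (fun i => hgm.comp (hS i))
      (fun i ω => ⟨by positivity, (div_le_one (by positivity)).2
        (sq_le_sq.2 ((hF f hf _).trans (le_abs_self z)))⟩)
      (hind.comp (fun _ x => f x ^ 2 / z ^ 2) fun _ => hgm)
      (fun i => by
        rw [integral_div, ← hlaw i,
          integral_map (hS i).aemeasurable (hfm.pow_const 2).aestronglyMeasurable])
      hl (m * c / z ^ 2)
    refine (measureReal_mono fun ω hω => ?_).trans (hchern.trans_eq ?_)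
    · have hω' : empWimpyVariance F (fun i => S i ω) ≤ c := hω
      change ∑ i, f (S i ω) ^ 2 / z ^ 2 ≤ m * c / z ^ 2
      rw [← Finset.sum_div]
      gcongr
      exact (sum_sq_le_mul_empWimpyVariance hm hF hf fun i => S i ω).trans (by gcongr)
    · congr 1
      ring
  -- The supremum need not be attained. If the bound failed at `σ²`, by continuity it would fail at
  -- some nearby `∫ f² dμ`, against `key`.
  have hcont : Continuous fun v : ℝ =>
      Real.exp (m / z ^ 2 * (l * c + v * (Real.exp (-l) - 1))) := by fun_prop
  by_contra! hlt
  have hev := hcont.continuousAt.eventually (gt_mem_nhds hlt)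
  obtain ⟨r, hr, hball⟩ := Metric.eventually_nhds_iff.1 hev
  by_cases hb : BddAbove (Set.range fun f : F => ∫ x, (f : 𝓧 → ℝ) x ^ 2 ∂μ)
  · obtain ⟨f, hf⟩ := exists_lt_of_lt_ciSup (sub_lt_self (wimpyVariance F μ) hr)
    have hle : ∫ x, (f : 𝓧 → ℝ) x ^ 2 ∂μ ≤ wimpyVariance F μ := le_ciSup hb f
    refine absurd (hball (y := ∫ x, (f : 𝓧 → ℝ) x ^ 2 ∂μ) ?_) (key f).not_gt
    rw [Real.dist_eq, abs_lt]
    constructor <;> linarith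
  · refine hb ⟨z ^ 2, ?_⟩
    rintro _ ⟨⟨f, hf⟩, rfl⟩
    have i : Fin m := ⟨0, hm⟩
    have : IsProbabilityMeasure μ := hlaw i ▸ Measure.isProbabilityMeasure_map (hS i).aemeasurable
    have h := integral_mono_of_nonneg (μ := μ) (f := fun x => f x ^ 2) (g := fun _ => z ^ 2)
      (Filter.Eventually.of_forall fun x => sq_nonneg _) (integrable_const _)
      (Filter.Eventually.of_forall fun x => sq_le_sq.2 ((hF f hf _).trans (le_abs_self z)))
    simpa using h

/-- Bennett-type lower tail bound for the empirical wimpy variance. -/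
lemma measureReal_empWimpyVariance_le_exp_bennettH (hm : 0 < m) (hne : F.Nonempty) (hz : 0 < z)
    (hFm : ∀ f ∈ F, Measurable f) (hF : ∀ f ∈ F, ∀ x, |f x| ≤ z)
    (hS : ∀ i, Measurable (S i)) (hind : iIndepFun S P) (hlaw : ∀ i, P.map (S i) = μ)
    (hv : 0 < wimpyVariance F μ) {ε : ℝ} (hε : 0 ≤ ε) (hεv : ε ≤ wimpyVariance F μ) :
    P.real {ω | wimpyVariance F μ ≥ empWimpyVariance F (fun i => S i ω) + ε} ≤
      Real.exp (-((m : ℝ) * wimpyVariance F μ / z ^ 2 *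
        bennettH (-(ε / wimpyVariance F μ)))) := by
  have hset : {ω | wimpyVariance F μ ≥ empWimpyVariance F (fun i => S i ω) + ε} =
      {ω | empWimpyVariance F (fun i => S i ω) ≤ wimpyVariance F μ - ε} := by
    ext ω
    simp only [Set.mem_ofPred_eq, ge_iff_le, le_sub_iff_add_le]
  have hmain := fun (l : ℝ) (hl : 0 ≤ l) => measureReal_empWimpyVariance_add_le
    hm hne hz hFm hF hS hind hlaw (wimpyVariance F μ - ε) hl
  rw [hset]
  set v := wimpyVariance F μ
  rcases hεv.eq_or_lt with rfl | hlt
  -- For `ε = v` the optimal parameter is infinite, so the bound is obtained in the limit `l → ∞`.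
  · have hlim : Filter.Tendsto (fun l : ℝ =>
        Real.exp (m / z ^ 2 * (l * (v - v) + v * (Real.exp (-l) - 1)))) Filter.atTop
        (nhds (Real.exp (m / z ^ 2 * (0 + v * (0 - 1))))) := by
      simp only [sub_self, mul_zero]
      exact (Real.continuous_exp.tendsto _).comp

          ((((Real.tendsto_exp_neg_atTop_nhds_zero.sub_const 1).const_mul v).const_add 0).const_mul _)
    refine (ge_of_tendsto hlim ((Filter.eventually_ge_atTop 0).mono hmain)).trans_eq ?_
    rw [div_self hv.ne']
    unfold bennettH
    norm_num
    ring
  · have hu : 0 < 1 + -(ε / v) := by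
      have : ε / v < 1 := (div_lt_one hv).2 hlt
      linarith
    have hlog : Real.log (1 + -(ε / v)) ≤ 0 :=
      Real.log_nonpos hu.le (by have : 0 ≤ ε / v := by positivity
                                linarith)
    -- The parameter `l = -log (1 - ε/v)` minimizes the exponent.
    refine (hmain _ (neg_nonneg.2 hlog)).trans_eq ?_
    rw [neg_neg, Real.exp_log hu]
    unfold bennettH
    congr 1
    field_simp
    ring

end Sample

theorem mainTheorem5 {𝓧 Ω : Type*} [MeasurableSpace 𝓧] [MeasurableSpace Ω]
    (P : Measure Ω) [IsProbabilityMeasure P]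
    (μ : Measure 𝓧) [IsProbabilityMeasure μ]
    (a b z : ℝ) (ha : a ≤ 0) (hb : 0 < b) (hz : z = max |a| |b|)
    (F : Set (𝓧 → ℝ)) (hF : F.Nonempty)
    (hFmeas : ∀ f ∈ F, Measurable f)
    (hFab : ∀ f ∈ F, ∀ x, f x ∈ Set.Icc a b)
    (m : ℕ) (hm : 0 < m) (S : Fin m → Ω → 𝓧)
    (hSmeas : ∀ i, Measurable (S i))
    (hSindep : iIndepFun S P)
    (hSlaw : ∀ i, P.map (S i) = μ)
    (hmeas : AEMeasurable (fun ω => empWimpyVariance F (fun i => S i ω)) P) :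
    IsSelfBounding 1 0 (fun s : Fin m → 𝓧 => (m : ℝ) * empWimpyVariance F s / z ^ 2) ∧
    (Integrable (fun ω => empWimpyVariance F (fun i => S i ω)) P ∧
      wimpyVariance F μ ≤ ∫ ω, empWimpyVariance F (fun i => S i ω) ∂P) ∧
    (0 < wimpyVariance F μ → ∀ ε : ℝ, 0 ≤ ε → ε ≤ wimpyVariance F μ →
      P.real {ω | wimpyVariance F μ ≥ empWimpyVariance F (fun i => S i ω) + ε} ≤
          Real.exp (-((m : ℝ) * wimpyVariance F μ / z ^ 2 *
            bennettH (-(ε / wimpyVariance F μ)))) ∧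
      Real.exp (-((m : ℝ) * wimpyVariance F μ / z ^ 2 *
            bennettH (-(ε / wimpyVariance F μ)))) ≤
          Real.exp (-((m : ℝ) * ε ^ 2 / (2 * z ^ 2 * wimpyVariance F μ)))) ∧
    (∀ δ : ℝ, 0 < δ → δ ≤ 1 →
      1 - δ ≤ P.real {ω | wimpyVariance F μ ≤
        empWimpyVariance F (fun i => S i ω) + z ^ 2 * Real.log (1 / δ) / m +
          Real.sqrt ((z ^ 2 * Real.log (1 / δ) / m) ^ 2 +
            2 * z ^ 2 * empWimpyVariance F (fun i => S i ω) * Real.log (1 / δ) / m)}) := by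
  have hzpos : 0 < z := hz ▸ lt_max_of_lt_right (abs_pos.2 hb.ne')
  have hFz : ∀ f ∈ F, ∀ x, |f x| ≤ z := fun f hf x =>
    hz ▸ abs_le_max_abs_abs (hFab f hf x).1 (hFab f hf x).2
  have hm' : (0 : ℝ) < m := by positivity
  have htail : 0 < wimpyVariance F μ → ∀ ε : ℝ, 0 ≤ ε → ε ≤ wimpyVariance F μ →
      P.real {ω | wimpyVariance F μ ≥ empWimpyVariance F (fun i => S i ω) + ε} ≤
          Real.exp (-((m : ℝ) * wimpyVariance F μ / z ^ 2 *
            bennettH (-(ε / wimpyVariance F μ)))) ∧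
      Real.exp (-((m : ℝ) * wimpyVariance F μ / z ^ 2 *
            bennettH (-(ε / wimpyVariance F μ)))) ≤
          Real.exp (-((m : ℝ) * ε ^ 2 / (2 * z ^ 2 * wimpyVariance F μ))) := by
    intro hv ε hε hεv
    refine ⟨measureReal_empWimpyVariance_le_exp_bennettH hm hF hzpos hFmeas hFz hSmeas hSindep
      hSlaw hv hε hεv, ?_⟩
    rw [Real.exp_le_exp, neg_le_neg_iff]
    calc (m : ℝ) * ε ^ 2 / (2 * z ^ 2 * wimpyVariance F μ)
        = m * wimpyVariance F μ / z ^ 2 * ((ε / wimpyVariance F μ) ^ 2 / 2) := by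
          field_simp
      _ ≤ _ := by
          gcongr
          exact sq_div_two_le_bennettH_neg (by positivity) ((div_le_one hv).2 hεv)
  refine ⟨isSelfBounding_empWimpyVariance hm hF hzpos hFz,
    ⟨integrable_empWimpyVariance hm hFz hmeas,
      wimpyVariance_le_integral hm hF hFmeas hFz hSmeas hSlaw hmeas⟩, htail, ?_⟩
  intro δ hδ hδ1
  have hL : 0 ≤ Real.log (1 / δ) := Real.log_nonneg (by rwa [one_le_div hδ])
  set A := z ^ 2 * Real.log (1 / δ) / m with hAdef
  have hA : 0 ≤ A := by positivity
  have hrw (u : ℝ) : 2 * z ^ 2 * u * Real.log (1 / δ) / m = 2 * A * u := by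
    rw [hAdef]; ring
  simp only [hrw]
  set good := {ω | wimpyVariance F μ ≤ empWimpyVariance F (fun i => S i ω) + A +
    Real.sqrt (A ^ 2 + 2 * A * empWimpyVariance F (fun i => S i ω))}
  have hv0 : 0 ≤ wimpyVariance F μ :=
    Real.iSup_nonneg fun _ => integral_nonneg fun _ => sq_nonneg _
  -- If `σ² ≤ 2A`, the term `A` and the square root, itself at least `A`, already cover `σ²` surely.
  -- Otherwise `√(2Aσ²) ≤ σ²`, so this `ε` is admissible in the tail bound, where it gives exactly
  -- `δ`.
  rcases le_or_gt (wimpyVariance F μ) (2 * A) with hsmall | hbig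
  · have huniv : good = Set.univ := by
      refine Set.eq_univ_of_forall fun ω => ?_
      have hu := empWimpyVariance_nonneg (F := F) fun i => S i ω
      have : A ≤ Real.sqrt (A ^ 2 + 2 * A * empWimpyVariance F (fun i => S i ω)) :=
        Real.le_sqrt_of_sq_le (le_add_of_nonneg_right (by positivity))
      change wimpyVariance F μ ≤ _
      linarith
    rw [huniv, probReal_univ]
    linarith
  · have hv : 0 < wimpyVariance F μ := by linarith
    obtain ⟨h1, h2⟩ := htail hv (Real.sqrt (2 * A * wimpyVariance F μ)) (Real.sqrt_nonneg _)
      (Real.sqrt_le_iff.2 ⟨hv0, by nlinarith⟩)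
    have hbad := h1.trans h2
    have hδeq : Real.exp (-((m : ℝ) * Real.sqrt (2 * A * wimpyVariance F μ) ^ 2 /
        (2 * z ^ 2 * wimpyVariance F μ))) = δ := by
      rw [Real.sq_sqrt (by positivity), hAdef]
      have : (m : ℝ) * (2 * (z ^ 2 * Real.log (1 / δ) / m) * wimpyVariance F μ) /
          (2 * z ^ 2 * wimpyVariance F μ) = Real.log (1 / δ) := by
        field_simp
      rw [this, one_div, Real.log_inv, neg_neg, Real.exp_log hδ]
    rw [hδeq] at hbad
    -- Subadditivity over a cover, rather than passing to a complement, avoids any measurability of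
    -- the events.
    have hcover : (Set.univ : Set Ω) ⊆ good ∪ {ω | wimpyVariance F μ ≥
        empWimpyVariance F (fun i => S i ω) + Real.sqrt (2 * A * wimpyVariance F μ)} := by
      intro ω _
      by_cases h : wimpyVariance F μ <
          empWimpyVariance F (fun i => S i ω) + Real.sqrt (2 * A * wimpyVariance F μ)
      · exact Or.inl (le_add_sqrt_of_lt_add_sqrt hA h)
      · exact Or.inr (not_lt.1 h)
    have hsum := (measureReal_mono (μ := P) hcover).trans (measureReal_union_le _ _)
    rw [probReal_univ] at hsum
    linarith
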